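/- For a sequence $\mathcal{D}=(d_1,\dots,d_n)$ of positive integers that is feasible (that is, there is a simple graph on $\{1,\dots,n\}$ in which vertex $i$ has degree $d_i$ for every $i$), let $G(\mathcal{D})$ be a uniformly random graph among all simple graphs on $\{1,\dots,n\}$ in which vertex $i$ has degree $d_i$ for every $i$, and let $M_{\mathcal{D}}=\sum_{i:\,d_i\neq 2}d_i$. For every real $b\ge 0$ and every $0<\gamma<\frac18$ there exist a positive integer $n_{b,\gamma}$ and a real number $0<\delta<1$ such that for every $n>n_{b,\gamma}$ and every feasible sequence $\mathcal{D}$ of $n$ positive integers with $M_{\mathcal{D}}\le b$, $$\delta\;\le\;\mathbb{P}\bigl[\,G(\mathcal{D})\text{ has a connected component with at least }\gamma n\text{ vertices}\,\bigr]\;\le\;1-\delta .$$ -/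

import Mathlib

namespace RandomDegreeGraph

/-- The simple graphs on the vertex set `Fin n` in which every vertex `i` has degree `D i`. -/
def realizations {n : ℕ} (D : Fin n → ℕ) : Set (SimpleGraph (Fin n)) :=
  {G | ∀ i, (G.neighborSet i).ncard = D i}

/-- A degree sequence is feasible if some simple graph has it as its degree sequence. -/
def Feasible {n : ℕ} (D : Fin n → ℕ) : Prop :=
  (realizations D).Nonempty

/-- The sum of the degrees that are different from `2`. -/
def sumDegNeTwo {n : ℕ} (D : Fin n → ℕ) : ℕ :=
  ∑ i ∈ Finset.univ.filter (fun i => D i ≠ 2), D i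

/-- The probability that a uniformly chosen simple graph with degree sequence `D` has the
property `P`: the proportion of the graphs with degree sequence `D` that satisfy `P`. It is
meaningful for feasible `D`. -/
noncomputable def prob {n : ℕ} (D : Fin n → ℕ) (P : SimpleGraph (Fin n) → Prop) : ℝ :=
  ((realizations D ∩ {G | P G}).ncard : ℝ) / ((realizations D).ncard : ℝ)

/-- `G` has a connected component with at least `x` vertices. -/
def HasComponentOfOrderAtLeast {n : ℕ} (x : ℝ) (G : SimpleGraph (Fin n)) : Prop :=
  ∃ c : G.ConnectedComponent, x ≤ (c.supp.ncard : ℝ)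

end RandomDegreeGraph

/-! Both bounds come from switchings, which replace edges `uv`, `xy` by `ux`, `vy`. The degree sum
is at most `3n` for large `n`, so at most `9n²` labelled switches lead into a given graph. If every
graph in `A` has at least `p` of order `n²` switches into `B`, then `|A| ≤ C|B|` with `C` constant
(`ncard_mul_le_of_switch`). A bounded number of such rounds costs only a constant factor.

Long paths of degree-2 vertices supply quadratically many switches. From a degree-2 vertex the walk
is forced. It yields a path on `l` degree-2 vertices unless it meets one of the boundedly many
vertices of other degree, or closes a short cycle (`le_ncard_pathStarts`). The first obstruction
spoils only `O(l)` starts.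

No large component: a large component contains a path of `3t + 1` degree-2 vertices, `t` being a
small multiple of `n`. Cutting a cycle out of that path takes at least `t` vertices out of large
components without creating new ones. Boundedly many rounds leave no large component
(`ncard_realizations_le_of_cutOff`).

Large component: inserting a short cycle into an edge elsewhere shows that a given vertex lies on a
degree-2 cycle of given small length with probability `O(1/n)`. Hence at least half of the
realizations have at most `n/4` vertices on short cycles. Such a graph contains boundedly many
disjoint linear-length paths covering about `n/6` vertices. Switching them together one by one, with
small losses at the ends, gives a single path on at least `n/8` vertices
(`ncard_realizations_le_of_merge`). -/

namespace RandomDegreeGraph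

/-! ### Double counting -/

section Counting

/-- Double counting: `A` has at least `p` labelled moves out of each of its elements, a move and
its label determine the source, and every target admits at most `q` labels. -/
theorem ncard_mul_le_ncard_mul {α τ : Type*} [Finite α] [Finite τ] {A B : Set α} (f : α → τ → α)
    (T T' : α → Set τ) {p q : ℕ} (hT : ∀ G ∈ A, p ≤ (T G).ncard)
    (hB : ∀ G ∈ A, ∀ t ∈ T G, f G t ∈ B) (hf : ∀ G ∈ A, ∀ t ∈ T G, t ∈ T' (f G t))
    (hinj : ∀ G ∈ A, ∀ H ∈ A, ∀ t ∈ T G, t ∈ T H → f G t = f H t → G = H)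
    (hT' : ∀ G ∈ B, (T' G).ncard ≤ q) : A.ncard * p ≤ B.ncard * q := by
  classical
  have := Fintype.ofFinite α
  have := Fintype.ofFinite τ
  simp only [Set.ncard_eq_toFinset_card'] at *
  have h1 : (A.toFinset.sigma fun G => (T G).toFinset).card ≤
      (B.toFinset.sigma fun G => (T' G).toFinset).card := by
    apply Finset.card_le_card_of_injOn (fun z => (⟨f z.1 z.2, z.2⟩ : Σ _ : α, τ))
    · rintro ⟨G, t⟩ h
      simp only [Finset.coe_sigma, Set.mem_sigma_iff, Set.coe_toFinset] at h ⊢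
      exact ⟨hB G h.1 t h.2, hf G h.1 t h.2⟩
    · rintro ⟨G, t⟩ h ⟨H, s⟩ h' he
      simp only [Finset.coe_sigma, Set.mem_sigma_iff, Set.coe_toFinset] at h h'
      simp only [Sigma.mk.injEq, heq_eq_eq] at he
      obtain ⟨he, rfl⟩ := he
      simp [hinj G h.1 H h'.1 t h.2 h'.2 he]
  rw [Finset.card_sigma, Finset.card_sigma] at h1
  calc _ ≤ ∑ G ∈ A.toFinset, (T G).toFinset.card := by
        rw [← smul_eq_mul]
        exact Finset.card_nsmul_le_sum _ _ _ (fun G hG => hT G (by simpa using hG))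
    _ ≤ _ := h1
    _ ≤ _ := by
        rw [← smul_eq_mul]
        exact Finset.sum_le_card_nsmul _ _ _ (fun G hG => hT' G (by simpa using hG))

/-- A set whose elements have codes in `C`, each code belonging to at most one element, is at most
as large as `C`. -/
theorem ncard_le_ncard_of_codes {α β : Type*} [Finite β] {S : Set α} {C : Set β}
    (r : α → β → Prop) (h : ∀ a ∈ S, ∃ c ∈ C, r a c)
    (hr : ∀ a ∈ S, ∀ a' ∈ S, ∀ c, r a c → r a' c → a = a') : S.ncard ≤ C.ncard := by
  rcases S.eq_empty_or_nonempty with rfl | ⟨a₀, ha₀⟩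
  · simp
  have : Nonempty β := (h a₀ ha₀).nonempty
  choose! g hg using h
  exact Set.ncard_le_ncard_of_injOn g (fun a ha => (hg a ha).1)
    (fun a ha a' ha' he => hr a ha a' ha' (g a) (hg a ha).2 (he ▸ (hg a' ha').2)) (Set.toFinite _)

theorem mul_le_ncard_of_injective {β : Type*} [Finite β] {S : Set β} {s t : ℕ} (f : ℕ → ℕ → β)
    (hf : ∀ a < s, ∀ b < t, f a b ∈ S)
    (hinj : ∀ a < s, ∀ b < t, ∀ a' < s, ∀ b' < t, f a b = f a' b' → a = a' ∧ b = b') :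
    s * t ≤ S.ncard := by
  have h := Set.ncard_le_ncard_of_injOn (s := (Set.univ : Set (Fin s × Fin t))) (t := S)
    (fun z => f z.1 z.2) (fun z _ => hf _ z.1.2 _ z.2.2)
    (fun z _ z' _ he => by
      obtain ⟨h1, h2⟩ := hinj _ z.1.2 _ z.2.2 _ z'.1.2 _ z'.2.2 he
      exact Prod.ext (Fin.ext h1) (Fin.ext h2)) (Set.toFinite _)
  simpa [Set.ncard_univ] using h

end Counting

/-! ### Switchings -/

section Switch

variable {V : Type*}

/-- Delete the edges `uv`, `xy` and insert the edges `ux`, `vy`. -/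
def switch (G : SimpleGraph V) (u v x y : V) : SimpleGraph V where
  Adj a b := a ≠ b ∧ ((G.Adj a b ∧ s(a, b) ≠ s(u, v) ∧ s(a, b) ≠ s(x, y)) ∨
    s(a, b) = s(u, x) ∨ s(a, b) = s(v, y))
  symm := ⟨by
    intro a b h
    rw [Sym2.eq_swap, G.adj_comm b a]
    exact ⟨h.1.symm, h.2⟩⟩
  loopless := ⟨fun a h => h.1 rfl⟩

/-- The four vertices are distinct and the switch replaces two edges by two non-edges. -/
structure CanSwitch (G : SimpleGraph V) (u v x y : V) : Prop where
  uv : G.Adj u v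
  xy : G.Adj x y
  ux : ¬ G.Adj u x
  vy : ¬ G.Adj v y
  ne_ux : u ≠ x
  ne_vy : v ≠ y
  ne_uy : u ≠ y
  ne_vx : v ≠ x

/-- Reversibility makes the source recoverable from the label and the target, as double counting
requires. -/
theorem switch_switch {G : SimpleGraph V} {u v x y : V} (h : CanSwitch G u v x y) :
    switch (switch G u v x y) u x v y = G := by
  obtain ⟨h1, h2, h3, h4, h5, h6, h7, h8⟩ := h
  ext a b
  have := h1.symm
  have := h2.symm
  have := G.adj_comm u x
  have := G.adj_comm v y
  have h9 := h1.ne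
  have h10 := h2.ne
  have := G.ne_of_adj (a := a) (b := b)
  simp only [switch, Sym2.eq_iff, ne_eq]
  grind

theorem switch_adj_left {G : SimpleGraph V} {u v x y : V} (h : CanSwitch G u v x y) :
    (switch G u v x y).Adj u x := ⟨h.ne_ux, by simp⟩

theorem switch_adj_right {G : SimpleGraph V} {u v x y : V} (h : CanSwitch G u v x y) :
    (switch G u v x y).Adj v y := ⟨h.ne_vy, by simp⟩

theorem ncard_neighborSet_switch {G : SimpleGraph V} {u v x y : V} (h : CanSwitch G u v x y)
    (a : V) : ((switch G u v x y).neighborSet a).ncard = (G.neighborSet a).ncard := by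
  classical
  obtain ⟨h1, h2, h3, h4, h5, h6, h7, h8⟩ := h
  have := h1.symm
  have := h2.symm
  have := G.adj_comm u x
  have := G.adj_comm v y
  have h9 := h1.ne
  have h10 := h2.ne
  suffices ∃ e : Equiv.Perm V, ∀ b, (switch G u v x y).Adj a b ↔ G.Adj a (e b) by
    obtain ⟨e, he⟩ := this
    have : (switch G u v x y).neighborSet a = e ⁻¹' (G.neighborSet a) := by
      ext b; simp [he]
    rw [this, ← Equiv.image_symm_eq_preimage]
    exact Set.ncard_image_of_injective _ e.symm.injective
  -- Each of the four vertices trades one neighbour for another, so a transposition of those two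
  -- matches the neighbourhoods.
  refine ⟨if a = u then Equiv.swap v x else if a = v then Equiv.swap u y else
    if a = x then Equiv.swap y u else if a = y then Equiv.swap x v else 1, fun b => ?_⟩
  have := G.ne_of_adj (a := a) (b := b)
  have := Equiv.swap_apply_def v x b
  have := Equiv.swap_apply_def u y b
  have := Equiv.swap_apply_def y u b
  have := Equiv.swap_apply_def x v b
  have : (1 : Equiv.Perm V) b = b := rfl
  simp only [switch, Sym2.eq_iff, ne_eq]
  split_ifs <;> grind

theorem switch_mem_realizations {n : ℕ} {D : Fin n → ℕ} {G : SimpleGraph (Fin n)}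
    {u v x y : Fin n} (hG : G ∈ realizations D) (h : CanSwitch G u v x y) :
    switch G u v x y ∈ realizations D :=
  fun i => (ncard_neighborSet_switch h i).trans (hG i)

theorem ncard_adj_of_mem {n : ℕ} {D : Fin n → ℕ} {G : SimpleGraph (Fin n)}
    (hG : G ∈ realizations D) (S : Finset (Fin n)) :
    {z : Fin n × Fin n | z.1 ∈ S ∧ G.Adj z.1 z.2}.ncard = ∑ i ∈ S, D i := by
  classical
  rw [Set.ncard_eq_toFinset_card']
  have : {z : Fin n × Fin n | z.1 ∈ S ∧ G.Adj z.1 z.2}.toFinset.card =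
      (S.sigma fun i => (G.neighborSet i).toFinset).card :=
    Finset.card_bij' (fun z _ => ⟨z.1, z.2⟩) (fun z _ => (z.1, z.2)) (by simp) (by simp)
      (by simp) (by simp)
  rw [this, Finset.card_sigma]
  exact Finset.sum_congr rfl fun i _ => by rw [← hG i, Set.ncard_eq_toFinset_card']

/-- Bounds the labels of switches leading into `G`: the inserted edges `ux` and `vy` form an ordered
pair of oriented edges of `G`. -/
theorem ncard_adj_prod_adj {n : ℕ} {D : Fin n → ℕ} {G : SimpleGraph (Fin n)}
    (hG : G ∈ realizations D) :
    {t : Fin n × Fin n × Fin n × Fin n | G.Adj t.1 t.2.2.1 ∧ G.Adj t.2.1 t.2.2.2}.ncard ≤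
      (∑ i, D i) * ∑ i, D i := by
  have h := ncard_adj_of_mem hG Finset.univ
  simp only [Finset.mem_univ, true_and] at h
  rw [← h, ← Set.ncard_prod]
  refine Set.ncard_le_ncard_of_injOn (fun t => ((t.1, t.2.2.1), (t.2.1, t.2.2.2))) ?_ ?_
    (Set.toFinite _)
  · intro t ht
    exact ht
  · rintro ⟨a, b, c, d⟩ _ ⟨a', b', c', d'⟩ _ he
    simp only [Prod.mk.injEq] at he ⊢
    tauto

/-- If each graph in `A` can be switched into `B` in at least `p` ways, then `B` is not much
smaller than `A`. -/
theorem ncard_mul_le_of_switch {n : ℕ} {D : Fin n → ℕ} {A B : Set (SimpleGraph (Fin n))}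
    (hBR : B ⊆ realizations D) {p : ℕ}
    (h : ∀ G ∈ A, p ≤ {t : Fin n × Fin n × Fin n × Fin n |
      CanSwitch G t.1 t.2.1 t.2.2.1 t.2.2.2 ∧ switch G t.1 t.2.1 t.2.2.1 t.2.2.2 ∈ B}.ncard) :
    A.ncard * p ≤ B.ncard * ((∑ i, D i) * ∑ i, D i) := by
  refine ncard_mul_le_ncard_mul (fun G t => switch G t.1 t.2.1 t.2.2.1 t.2.2.2) _
    (fun G => {t | G.Adj t.1 t.2.2.1 ∧ G.Adj t.2.1 t.2.2.2}) h (fun G _ t ht => ht.2)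
    (fun G _ t ht => ⟨switch_adj_left ht.1, switch_adj_right ht.1⟩) ?_
    (fun G hG => ncard_adj_prod_adj (hBR hG))
  intro G _ H _ t ht ht' he
  rw [← switch_switch ht.1, ← switch_switch ht'.1]
  exact congrArg (fun K => switch K _ _ _ _) he

end Switch

end RandomDegreeGraph

namespace RandomDegreeGraph

/-! ### Paths and cycles of vertices of degree 2 -/

section DPath

variable {n : ℕ} {D : Fin n → ℕ} {G : SimpleGraph (Fin n)}

theorem eq_or_eq_of_adj (hG : G ∈ realizations D) {w a c d : Fin n} (hw : D w = 2)
    (ha : G.Adj w a) (hc : G.Adj w c) (hac : a ≠ c) (hd : G.Adj w d) : d = a ∨ d = c := by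
  obtain ⟨s, t, -, h⟩ := Set.ncard_eq_two.1 ((hG w).trans hw)
  have key : ∀ z, G.Adj w z ↔ z = s ∨ z = t := fun z => by
    rw [← G.mem_neighborSet, h]; simp
  grind

theorem exists_adj_ne (hG : G ∈ realizations D) {w : Fin n} (hw : D w = 2) (a : Fin n) :
    ∃ c, G.Adj w c ∧ c ≠ a := by
  obtain ⟨s, t, hst, h⟩ := Set.ncard_eq_two.1 ((hG w).trans hw)
  have key : ∀ z, G.Adj w z ↔ z = s ∨ z = t := fun z => by
    rw [← G.mem_neighborSet, h]; simp
  by_cases hs : s = a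
  · exact ⟨t, (key t).2 (Or.inr rfl), fun h => hst (hs.trans h.symm)⟩
  · exact ⟨s, (key s).2 (Or.inl rfl), hs⟩

/-- `p 0, …, p (k - 1)` is a path in `G` all of whose vertices have prescribed degree `2`. -/
structure DPath (D : Fin n → ℕ) (G : SimpleGraph (Fin n)) (p : ℕ → Fin n) (k : ℕ) : Prop where
  deg : ∀ i < k, D (p i) = 2
  adj : ∀ i, i + 1 < k → G.Adj (p i) (p (i + 1))
  inj : ∀ i < k, ∀ j < k, p i = p j → i = j

theorem DPath.mono {p : ℕ → Fin n} {k l : ℕ} (h : DPath D G p k) (hl : l ≤ k) :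
    DPath D G p l :=
  ⟨fun i hi => h.deg i (by omega), fun i hi => h.adj i (by omega),
    fun i hi j hj => h.inj i (by omega) j (by omega)⟩

theorem DPath.reverse {p : ℕ → Fin n} {k : ℕ} (h : DPath D G p k) :
    DPath D G (fun i => p (k - 1 - i)) k := by
  refine ⟨fun i hi => h.deg _ (by omega), fun i hi => ?_, fun i hi j hj he => ?_⟩
  · have := h.adj (k - 1 - (i + 1)) (by omega)
    rw [show k - 1 - (i + 1) + 1 = k - 1 - i by omega] at this
    exact this.symm
  · have := h.inj _ (by omega) _ (by omega) he
    omega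

theorem DPath.eq_of_adj (hG : G ∈ realizations D) {p : ℕ → Fin n} {k i : ℕ}
    (h : DPath D G p k) (hi : i + 2 < k) {z : Fin n} (hz : G.Adj (p (i + 1)) z) :
    z = p i ∨ z = p (i + 2) := by
  refine eq_or_eq_of_adj hG (h.deg _ (by omega)) (h.adj i (by omega)).symm (h.adj _ hi) ?_ hz
  intro he
  have := h.inj _ (by omega) _ (by omega) he
  omega

/-- At a vertex of degree 2 the neighbour just left behind forces the next one; `a` plays that role
at the start. -/
theorem DPath.unique (hG : G ∈ realizations D) {p q : ℕ → Fin n} {k : ℕ} {a : Fin n}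
    (hp : DPath D G p k) (hq : DPath D G q k) (h0 : p 0 = q 0) (ha : G.Adj (p 0) a)
    (hap : 1 < k → a ≠ p 1) (haq : 1 < k → a ≠ q 1) : ∀ i < k, p i = q i := by
  intro i
  induction i using Nat.strong_induction_on with
  | _ i ih =>
    intro hi
    match i, ih, hi with
    | 0, _, _ => exact h0
    | 1, _, hi =>
      have h1 := hp.adj 0 hi
      have h2 := hq.adj 0 hi
      rw [← h0] at h2
      rcases eq_or_eq_of_adj hG (hp.deg 0 (by omega)) ha h1 (hap hi) h2 with h | h
      · exact absurd h.symm (haq hi)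
      · exact h.symm
    | i + 2, ih, hi =>
      have e0 := ih i (by omega) (by omega)
      have e1 := ih (i + 1) (by omega) (by omega)
      have h2 := hq.adj (i + 1) hi
      rw [← e1] at h2
      rcases hp.eq_of_adj hG hi h2 with h | h
      · rw [e0] at h
        have := hq.inj _ (by omega) _ (by omega) h
        omega
      · exact h.symm

/-- Uniqueness for the reversed paths. It lets a start be encoded by a length, an end and a
neighbour beyond that end. -/
theorem DPath.unique_start (hG : G ∈ realizations D) {p q : ℕ → Fin n} {j : ℕ} {a : Fin n}
    (hp : DPath D G p (j + 1)) (hq : DPath D G q (j + 1)) (h0 : p j = q j)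
    (ha : G.Adj (p j) a) (hap : 1 ≤ j → a ≠ p (j - 1)) (haq : 1 ≤ j → a ≠ q (j - 1)) :
    p 0 = q 0 := by
  have := hp.reverse.unique hG hq.reverse (a := a) (by simpa using h0) (by simpa using ha)
    (fun h => by simpa using hap (by omega)) (fun h => by simpa using haq (by omega)) j (by omega)
  simpa using this

/-- `p 0, …, p (k - 1)` is a cycle of `G` all of whose vertices have prescribed degree `2`. -/
structure DCycle (D : Fin n → ℕ) (G : SimpleGraph (Fin n)) (p : ℕ → Fin n) (k : ℕ) : Prop where
  path : DPath D G p k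
  three_le : 3 ≤ k
  close : G.Adj (p (k - 1)) (p 0)

/-- The vertices of degree `2` joined by a path of fewer than `l` vertices of degree `2` to a
vertex of another degree. -/
def nearSpecial (D : Fin n → ℕ) (G : SimpleGraph (Fin n)) (l : ℕ) : Set (Fin n) :=
  {v | ∃ p j, j < l ∧ DPath D G p (j + 1) ∧ p 0 = v ∧ ∃ y, G.Adj (p j) y ∧ D y ≠ 2}

/-- The vertices on cycles of fewer than `l` vertices, all of degree `2`. -/
def onShortCycle (D : Fin n → ℕ) (G : SimpleGraph (Fin n)) (l : ℕ) : Set (Fin n) :=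
  {v | ∃ p k, k < l ∧ DCycle D G p k ∧ p 0 = v}

/-- The path is grown from `v` one vertex at a time. It stops only at a vertex of another degree, or
on returning to itself, which can happen only at `v` because inner vertices have both neighbours on
the path. -/
theorem exists_dpath_or (hG : G ∈ realizations D) {v : Fin n} (hv : D v = 2) (l : ℕ)
    (h1 : v ∉ nearSpecial D G l) (h2 : v ∉ onShortCycle D G l) :
    ∃ p, DPath D G p l ∧ p 0 = v := by
  suffices ∀ m, m + 1 ≤ l → ∃ p, DPath D G p (m + 1) ∧ p 0 = v by
    rcases l with _ | l
    · exact ⟨fun _ => v, ⟨by simp, by simp, by simp⟩, rfl⟩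
    · exact this l le_rfl
  intro m
  induction m with
  | zero =>
    exact fun _ => ⟨fun _ => v, ⟨fun _ _ => hv, fun i hi => by omega, fun i hi j hj _ => by omega⟩,
      rfl⟩
  | succ m ih =>
    intro hm
    obtain ⟨p, hp, hp0⟩ := ih (by omega)
    -- For `m = 0` the excluded vertex is `p 0` itself, which is harmless.
    obtain ⟨y, hy, hne⟩ := exists_adj_ne hG (hp.deg m (by omega)) (p (m - 1))
    have hDy : D y = 2 := by
      by_contra h
      exact h1 ⟨p, m, by omega, hp, hp0, y, hy, h⟩
    have hnew : ∀ i < m + 1, p i ≠ y := by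
      rintro i hi rfl
      have him : i ≠ m := fun h => G.irrefl (h ▸ hy : G.Adj (p m) (p m))
      have him' : i ≠ m - 1 := fun h => hne (by rw [h])
      rcases i with _ | i
      · exact h2 ⟨p, m + 1, by omega, ⟨hp, by omega, by simpa using hy⟩, hp0⟩
      · rcases hp.eq_of_adj hG (i := i) (by omega) hy.symm with h | h
        · have := hp.inj _ (by omega) _ (by omega) h
          omega
        · have := hp.inj _ (by omega) _ (by omega) h
          omega
    refine ⟨Function.update p (m + 1) y, ⟨fun i hi => ?_, fun i hi => ?_, fun i hi j hj he => ?_⟩,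
      by simp [hp0]⟩
    · rcases eq_or_ne i (m + 1) with rfl | h
      · simpa using hDy
      · simpa [h] using hp.deg i (by omega)
    · rcases eq_or_ne i m with rfl | h
      · simpa using hy
      · have : i ≠ m + 1 := by omega
        simpa [h, this] using hp.adj i (by omega)
    · rcases eq_or_ne i (m + 1) with rfl | h <;> rcases eq_or_ne j (m + 1) with rfl | h'
      · rfl
      · simp only [Function.update_self, ne_eq, h', not_false_eq_true,
          Function.update_of_ne] at he
        exact absurd he.symm (hnew j (by omega))
      · simp only [Function.update_self, ne_eq, h, not_false_eq_true,
          Function.update_of_ne] at he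
        exact absurd he (hnew i (by omega))
      · simp only [ne_eq, h, h', not_false_eq_true, Function.update_of_ne] at he
        exact hp.inj i (by omega) j (by omega) he

/-- A vertex is coded by an oriented edge leaving a vertex of degree other than 2, together with the
number of steps back along the path. -/
theorem ncard_nearSpecial_le (hG : G ∈ realizations D) (l : ℕ) :
    (nearSpecial D G l).ncard ≤ sumDegNeTwo D * l := by
  have hC : ({z : Fin n × Fin n | z.1 ∈ Finset.univ.filter (fun i => D i ≠ 2) ∧ G.Adj z.1 z.2} ×ˢ
      (Set.univ : Set (Fin l))).ncard = sumDegNeTwo D * l := by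
    rw [Set.ncard_prod, ncard_adj_of_mem hG, Set.ncard_univ]
    simp [sumDegNeTwo]
  rw [← hC]
  refine ncard_le_ncard_of_codes (fun v c => ∃ p, DPath D G p (c.2 + 1) ∧ p 0 = v ∧
    p c.2 = c.1.2 ∧ G.Adj c.1.1 c.1.2 ∧ D c.1.1 ≠ 2) ?_ ?_
  · rintro v ⟨p, j, hj, hp, h0, y, hy, hDy⟩
    exact ⟨((y, p j), ⟨j, hj⟩), by simp [hDy, hy.symm], p, hp, h0, rfl, hy.symm, hDy⟩
  · rintro v - w - c ⟨p, hp, rfl, hpc, hadj, hD⟩ ⟨q, hq, rfl, hqc, -, -⟩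
    refine hp.unique_start hG hq (hpc.trans hqc.symm) (a := c.1.1) (hpc ▸ hadj.symm) ?_ ?_
    · intro _ h
      exact hD (h ▸ hp.deg _ (by omega))
    · intro _ h
      exact hD (h ▸ hq.deg _ (by omega))

/-- The vertices at which a path of `l` vertices of degree `2` starts. -/
def pathStarts (D : Fin n → ℕ) (G : SimpleGraph (Fin n)) (l : ℕ) : Set (Fin n) :=
  {v | ∃ p, DPath D G p l ∧ p 0 = v}

theorem ncard_ne_two_le (hD : ∀ i, 0 < D i) : {v | D v ≠ 2}.ncard ≤ sumDegNeTwo D := by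
  rw [Set.ncard_eq_toFinset_card', sumDegNeTwo, Finset.card_eq_sum_ones, Set.toFinset_ofPred]
  exact Finset.sum_le_sum fun i _ => hD i

/-- The set `S` is a large component in the cut-off argument and the whole vertex set in the merging
argument. -/
theorem le_ncard_pathStarts (hD : ∀ i, 0 < D i) (hG : G ∈ realizations D) (l : ℕ)
    (S : Set (Fin n)) :
    S.ncard ≤ sumDegNeTwo D + sumDegNeTwo D * l + (S ∩ onShortCycle D G l).ncard +
      (S ∩ pathStarts D G l).ncard := by
  have hsub : S ⊆ (({v | D v ≠ 2} ∪ nearSpecial D G l) ∪ (S ∩ onShortCycle D G l)) ∪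
      (S ∩ pathStarts D G l) := by
    intro v hv
    by_contra hc
    simp only [Set.mem_union, Set.mem_ofPred_eq, not_or, not_not, Set.mem_inter_iff, hv,
      true_and] at hc
    exact hc.2 (exists_dpath_or hG hc.1.1.1 l hc.1.1.2 hc.1.2)
  have h0 := Set.ncard_le_ncard hsub (Set.toFinite _)
  have h1 := Set.ncard_union_le (({v | D v ≠ 2} ∪ nearSpecial D G l) ∪ (S ∩ onShortCycle D G l))
    (S ∩ pathStarts D G l)
  have h2 := Set.ncard_union_le ({v | D v ≠ 2} ∪ nearSpecial D G l) (S ∩ onShortCycle D G l)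
  have h3 := Set.ncard_union_le {v | D v ≠ 2} (nearSpecial D G l)
  have h4 := ncard_ne_two_le hD
  have h5 := ncard_nearSpecial_le hG l
  omega

/-- Both neighbours of each vertex are already on the cycle, so the cycle is a whole component. -/
theorem DCycle.mem_of_adj (hG : G ∈ realizations D) {p : ℕ → Fin n} {k i : ℕ}
    (h : DCycle D G p k) (hi : i < k) {z : Fin n} (hz : G.Adj (p i) z) : ∃ j < k, z = p j := by
  have h3 := h.three_le
  rcases i with _ | i
  · rcases eq_or_eq_of_adj hG (h.path.deg 0 hi) h.close.symm (h.path.adj 0 (by omega))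
      (fun he => by have := h.path.inj _ (by omega) _ (by omega) he; omega) hz with e | e
    · exact ⟨k - 1, by omega, e⟩
    · exact ⟨1, by omega, e⟩
  · rcases eq_or_ne (i + 2) k with rfl | hk
    · rcases eq_or_eq_of_adj hG (h.path.deg (i + 1) hi) h.close (h.path.adj i (by omega)).symm
        (fun he => by have := h.path.inj _ (by omega) _ (by omega) he; omega) hz with e | e
      · exact ⟨0, by omega, e⟩
      · exact ⟨i, by omega, e⟩
    · rcases h.path.eq_of_adj hG (i := i) (by omega) hz with e | e
      · exact ⟨i, by omega, e⟩
      · exact ⟨i + 2, by omega, e⟩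

theorem DPath.ncard_image {p : ℕ → Fin n} {k : ℕ} (h : DPath D G p k) :
    (p '' Set.Iio k).ncard = k := by
  have hinj : Set.InjOn p (Set.Iio k) := fun i hi j hj => h.inj i hi j hj
  rw [hinj.ncard_image]
  simp [Set.ncard_eq_toFinset_card']

theorem DPath.reachable {p : ℕ → Fin n} {k i j : ℕ} (h : DPath D G p k) (hi : i < k)
    (hj : j < k) : G.Reachable (p i) (p j) := by
  have key : ∀ m, m < k → G.Reachable (p 0) (p m) := by
    intro m
    induction m with
    | zero => exact fun _ => SimpleGraph.Reachable.refl _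
    | succ m ih => exact fun hm => (ih (by omega)).trans (h.adj m hm).reachable
  exact (key i hi).symm.trans (key j hj)

end DPath

end RandomDegreeGraph

namespace RandomDegreeGraph

/-! ### Destroying large components by cutting off cycles -/

section CutOff

variable {n : ℕ} {D : Fin n → ℕ} {G : SimpleGraph (Fin n)}

/-- The vertices in components with at least `x` vertices. -/
def inLarge (x : ℝ) (G : SimpleGraph (Fin n)) : Set (Fin n) :=
  {w | x ≤ ((G.connectedComponentMk w).supp.ncard : ℝ)}

theorem hasComponent_iff_nonempty_inLarge (x : ℝ) :
    HasComponentOfOrderAtLeast x G ↔ (inLarge x G).Nonempty := by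
  constructor
  · rintro ⟨c, hc⟩
    obtain ⟨w, rfl⟩ := c.exists_rep
    exact ⟨w, hc⟩
  · rintro ⟨w, hw⟩
    exact ⟨_, hw⟩

theorem mem_of_reachable_of_closed {V : Type*} {H : SimpleGraph V} {X : Set V}
    (hX : ∀ a ∈ X, ∀ b, H.Adj a b → b ∈ X) {a b : V} (h : H.Reachable a b) (ha : a ∈ X) :
    b ∈ X := by
  obtain ⟨w⟩ := h
  induction w with
  | nil => exact ha
  | cons hadj _ ih => exact ih (hX _ ha _ hadj)

theorem reachable_of_forall_adj {V : Type*} {H K : SimpleGraph V} {X : Set V}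
    (hX : ∀ a ∈ X, ∀ b, H.Adj a b → b ∈ X)
    (hK : ∀ a ∉ X, ∀ b ∉ X, H.Adj a b → K.Reachable a b) {a b : V} (h : H.Reachable a b)
    (ha : a ∉ X) : K.Reachable a b := by
  obtain ⟨w⟩ := h
  induction w with
  | nil => exact SimpleGraph.Reachable.refl _
  | @cons c d e hadj _ ih =>
    have hd : d ∉ X := fun hd => ha (hX d hd c hadj.symm)
    exact (hK _ ha _ hd hadj).trans (ih hd)

/-- The bounds make `p i` and `p (i + 1)` inner vertices, whose neighbours are all known. The gap of
3 makes the cut-off part `p (i + 1), …, p j` long enough to close into a cycle. -/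
theorem DPath.canSwitch_cutOff (hG : G ∈ realizations D) {p : ℕ → Fin n} {l i j : ℕ}
    (h : DPath D G p l) (hi : 1 ≤ i) (hij : i + 3 ≤ j) (hj : j + 1 < l) :
    CanSwitch G (p i) (p (i + 1)) (p (j + 1)) (p j) := by
  have hne : ∀ a < l, ∀ c < l, a ≠ c → p a ≠ p c := fun a ha c hc hac he =>
    hac (h.inj a ha c hc he)
  refine ⟨h.adj i (by omega), (h.adj j (by omega)).symm, fun hadj => ?_, fun hadj => ?_,
    hne _ (by omega) _ (by omega) (by omega), hne _ (by omega) _ (by omega) (by omega),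
    hne _ (by omega) _ (by omega) (by omega), hne _ (by omega) _ (by omega) (by omega)⟩
  · obtain ⟨i, rfl⟩ : ∃ m, i = m + 1 := ⟨i - 1, by omega⟩
    rcases h.eq_of_adj hG (by omega) hadj with e | e
    · exact hne _ (by omega) _ (by omega) (by omega) e
    · exact hne _ (by omega) _ (by omega) (by omega) e
  · rcases h.eq_of_adj hG (by omega) hadj with e | e
    · exact hne _ (by omega) _ (by omega) (by omega) e
    · exact hne _ (by omega) _ (by omega) (by omega) e

/-- Cutting a cycle off a path of vertices in a large component diminishes the set of vertices in
large components. -/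
theorem DPath.ncard_inLarge_cutOff (hG : G ∈ realizations D) {p : ℕ → Fin n} {l i j : ℕ} {x : ℝ}
    (h : DPath D G p l) (hi : 1 ≤ i) (hij : i + 3 ≤ j) (hj : j + 1 < l) (hl : (l : ℝ) ≤ x)
    (h0 : p 0 ∈ inLarge x G) :
    (inLarge x (switch G (p i) (p (i + 1)) (p (j + 1)) (p j))).ncard + (j - i) ≤
      (inLarge x G).ncard := by
  set H := switch G (p i) (p (i + 1)) (p (j + 1)) (p j) with hH
  -- The vertex set of the new cycle. It is closed under adjacency in `H` and has fewer than `l ≤ x`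
  -- vertices, so it meets no large component of `H`. Outside it, components can only shrink.
  set X : Set (Fin n) := p '' Set.Ioc i j with hXdef
  have hXcard : X.ncard = j - i := by
    have hinj : Set.InjOn p (Set.Ioc i j) := fun a ha c hc =>
      h.inj a (by have := ha.2; omega) c (by have := hc.2; omega)
    rw [hXdef, hinj.ncard_image]
    simp [Set.ncard_eq_toFinset_card']
  have hclosed : ∀ a ∈ X, ∀ b, H.Adj a b → b ∈ X := by
    rintro _ ⟨m, ⟨hm1, hm2⟩, rfl⟩ b ⟨-, ⟨hadj, hne1, hne2⟩ | he | he⟩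
    · obtain ⟨m, rfl⟩ : ∃ r, m = r + 1 := ⟨m - 1, by omega⟩
      rcases h.eq_of_adj hG (by omega) hadj with rfl | rfl
      · refine ⟨m, ⟨?_, by omega⟩, rfl⟩
        by_contra hc
        obtain rfl : m = i := by omega
        exact hne1 Sym2.eq_swap
      · refine ⟨m + 2, ⟨by omega, ?_⟩, rfl⟩
        by_contra hc
        obtain rfl : m + 1 = j := by omega
        exact hne2 Sym2.eq_swap
    · rcases Sym2.eq_iff.1 he with ⟨e, -⟩ | ⟨e, -⟩
      · have := h.inj _ (by omega) _ (by omega) e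
        omega
      · have := h.inj _ (by omega) _ (by omega) e
        omega
    · rcases Sym2.eq_iff.1 he with ⟨-, rfl⟩ | ⟨-, rfl⟩
      · exact ⟨j, ⟨by omega, le_rfl⟩, rfl⟩
      · exact ⟨i + 1, ⟨by omega, by omega⟩, rfl⟩
  have hout : ∀ a ∉ X, ∀ b ∉ X, H.Adj a b → G.Reachable a b := by
    rintro a ha b hb ⟨-, ⟨hadj, -, -⟩ | he | he⟩
    · exact hadj.reachable
    · rcases Sym2.eq_iff.1 he with ⟨rfl, rfl⟩ | ⟨rfl, rfl⟩ <;>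
        exact h.reachable (by omega) (by omega)
    · rcases Sym2.eq_iff.1 he with ⟨rfl, rfl⟩ | ⟨rfl, rfl⟩ <;>
        exact h.reachable (by omega) (by omega)
  have hsub : inLarge x H ⊆ inLarge x G \ X := by
    intro w hw
    have hwX : w ∉ X := by
      intro hwX
      have hs : (H.connectedComponentMk w).supp ⊆ X := fun z hz =>
        mem_of_reachable_of_closed hclosed (SimpleGraph.ConnectedComponent.exact hz).symm hwX
      have h1 := Set.ncard_le_ncard hs (Set.toFinite _)
      have h2 : (((H.connectedComponentMk w).supp.ncard : ℕ) : ℝ) < l := by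
        exact_mod_cast (by omega : (H.connectedComponentMk w).supp.ncard < l)
      have h3 : x ≤ ((H.connectedComponentMk w).supp.ncard : ℝ) := hw
      linarith
    refine ⟨?_, hwX⟩
    have hs : (H.connectedComponentMk w).supp ⊆ (G.connectedComponentMk w).supp := fun z hz =>
      SimpleGraph.ConnectedComponent.sound (reachable_of_forall_adj hclosed hout
        (SimpleGraph.ConnectedComponent.exact hz).symm hwX).symm
    have h3 : x ≤ ((H.connectedComponentMk w).supp.ncard : ℝ) := hw
    exact h3.trans (by exact_mod_cast Set.ncard_le_ncard hs (Set.toFinite _))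
  have hXsub : X ⊆ inLarge x G := by
    rintro _ ⟨m, ⟨hm1, hm2⟩, rfl⟩
    have : G.connectedComponentMk (p m) = G.connectedComponentMk (p 0) :=
      SimpleGraph.ConnectedComponent.sound (h.reachable (by omega) (by omega))
    simpa only [inLarge, Set.mem_ofPred_eq, this] using h0
  have h1 := Set.ncard_le_ncard hsub (Set.toFinite _)
  have h2 := Set.ncard_sdiff_add_ncard_of_subset hXsub (Set.toFinite _)
  omega

/-- A cycle with fewer than `l ≤ x` vertices would be the entire component, so a large component has
no vertex on a short cycle. It is also too big to consist only of vertices of other degrees and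
vertices near them. -/
theorem exists_dpath_of_inLarge (hD : ∀ i, 0 < D i) (hG : G ∈ realizations D) {l : ℕ} {x : ℝ}
    (hl : (l : ℝ) ≤ x) (hx : ((sumDegNeTwo D + sumDegNeTwo D * l : ℕ) : ℝ) < x)
    (hne : (inLarge x G).Nonempty) : ∃ p, DPath D G p l ∧ p 0 ∈ inLarge x G := by
  obtain ⟨w, hw⟩ := hne
  have hw' : x ≤ ((G.connectedComponentMk w).supp.ncard : ℝ) := hw
  set S := (G.connectedComponentMk w).supp with hS
  have h1 := le_ncard_pathStarts hD hG l S
  have h2 : S ∩ onShortCycle D G l = ∅ := by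
    rw [Set.eq_empty_iff_forall_notMem]
    rintro v ⟨hvS, p, k, hk, hp, rfl⟩
    have hs : S ⊆ p '' Set.Iio k := fun z hz => by
      refine mem_of_reachable_of_closed (H := G) (a := p 0) ?_ ?_ ⟨0, ?_, rfl⟩
      · rintro _ ⟨m, hm, rfl⟩ b hb
        obtain ⟨r, hr, rfl⟩ := hp.mem_of_adj hG hm hb
        exact ⟨r, hr, rfl⟩
      · exact SimpleGraph.ConnectedComponent.exact
          ((show G.connectedComponentMk (p 0) = _ from hvS).trans hz.symm)
      · have := hp.three_le
        exact Set.mem_Iio.2 (by omega)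
    have h3 := Set.ncard_le_ncard hs (Set.toFinite _)
    rw [hp.path.ncard_image] at h3
    have : (S.ncard : ℝ) < l := by exact_mod_cast (by omega : S.ncard < l)
    linarith
  rw [h2, Set.ncard_empty] at h1
  have h4 : sumDegNeTwo D + sumDegNeTwo D * l < S.ncard := by
    exact_mod_cast hx.trans_le hw'
  have h5 : (S ∩ pathStarts D G l).ncard ≠ 0 := by omega
  obtain ⟨v, hvS, p, hp, rfl⟩ := Set.nonempty_of_ncard_ne_zero h5
  refine ⟨p, hp, ?_⟩
  have : G.connectedComponentMk (p 0) = G.connectedComponentMk w := hvS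
  simpa only [inLarge, Set.mem_ofPred_eq, this] using hw

theorem sq_le_ncard_cutOff (hD : ∀ i, 0 < D i) (hG : G ∈ realizations D) {t : ℕ} {x : ℝ}
    (ht : 3 ≤ t) (hl : ((3 * t + 1 : ℕ) : ℝ) ≤ x)
    (hx : ((sumDegNeTwo D + sumDegNeTwo D * (3 * t + 1) : ℕ) : ℝ) < x)
    (hne : (inLarge x G).Nonempty) :
    t * t ≤ {s : Fin n × Fin n × Fin n × Fin n | CanSwitch G s.1 s.2.1 s.2.2.1 s.2.2.2 ∧
      switch G s.1 s.2.1 s.2.2.1 s.2.2.2 ∈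
        {H | H ∈ realizations D ∧ (inLarge x H).ncard + t ≤ (inLarge x G).ncard}}.ncard := by
  obtain ⟨p, hp, h0⟩ := exists_dpath_of_inLarge hD hG hl hx hne
  refine mul_le_ncard_of_injective
    -- The first cut lies in `[1, t]` and the second in `[2t, 3t)`, so every cut-off cycle has at
    -- least `t` vertices.
    (fun a c => (p (a + 1), p (a + 1 + 1), p (2 * t + c + 1), p (2 * t + c))) ?_ ?_
  · intro a ha c hc
    have hs := hp.canSwitch_cutOff hG (i := a + 1) (j := 2 * t + c) (by omega) (by omega)
      (by omega)
    have hd := hp.ncard_inLarge_cutOff hG (i := a + 1) (j := 2 * t + c) (by omega) (by omega)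
      (by omega) hl h0
    refine ⟨hs, switch_mem_realizations hG hs, ?_⟩
    dsimp only
    omega
  · intro a ha c hc a' ha' c' hc' he
    simp only [Prod.mk.injEq] at he
    have h1 := hp.inj _ (by omega) _ (by omega) he.1
    have h2 := hp.inj _ (by omega) _ (by omega) he.2.2.2
    omega

theorem ncard_realizations_le_of_cutOff (hD : ∀ i, 0 < D i) {t C J : ℕ} {x : ℝ}
    (ht : 3 ≤ t) (hl : ((3 * t + 1 : ℕ) : ℝ) ≤ x)
    (hx : ((sumDegNeTwo D + sumDegNeTwo D * (3 * t + 1) : ℕ) : ℝ) < x)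
    (hC : (∑ i, D i) * ∑ i, D i ≤ C * (t * t)) (hJ : n ≤ J * t) :
    (realizations D).ncard ≤
      (1 + C) ^ J * (realizations D \ {G | HasComponentOfOrderAtLeast x G}).ncard := by
  -- Layers by the number of vertices in large components: each switch leads from layer `j + 1` into
  -- layer `j`, layer `J` is everything, and layer `0` has no large component.
  set A : ℕ → Set (SimpleGraph (Fin n)) := fun j =>
    {G | G ∈ realizations D ∧ (inLarge x G).ncard ≤ j * t} with hA
  have hstep : ∀ j, (A (j + 1)).ncard ≤ (1 + C) * (A j).ncard := by
    intro j
    have h1 : (A (j + 1) \ A j).ncard * (t * t) ≤ (A j).ncard * ((∑ i, D i) * ∑ i, D i) := by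
      refine ncard_mul_le_of_switch (fun G hG => hG.1) ?_
      rintro G ⟨⟨hG, hG1⟩, hG2⟩
      have hlt : j * t < (inLarge x G).ncard := by
        by_contra hc
        exact hG2 ⟨hG, by omega⟩
      have hne := Set.nonempty_of_ncard_ne_zero (by omega : (inLarge x G).ncard ≠ 0)
      refine (sq_le_ncard_cutOff hD hG ht hl hx hne).trans (Set.ncard_le_ncard ?_ (Set.toFinite _))
      rintro s ⟨hs1, hs2, hs3⟩
      refine ⟨hs1, hs2, ?_⟩
      have : (j + 1) * t = j * t + t := by ring
      omega
    have h2 : (A (j + 1) \ A j).ncard ≤ (A j).ncard * C := by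
      have : (A (j + 1) \ A j).ncard * (t * t) ≤ ((A j).ncard * C) * (t * t) := by
        refine h1.trans ((Nat.mul_le_mul_left _ hC).trans_eq (by ring))
      exact Nat.le_of_mul_le_mul_right this (by positivity)
    have h3 := Set.ncard_le_ncard_sdiff_add_ncard (A (j + 1)) (A j) (Set.toFinite _)
    calc _ ≤ _ := h3
      _ ≤ (A j).ncard * C + (A j).ncard := by omega
      _ = _ := by ring
  have hiter : ∀ j, (A j).ncard ≤ (1 + C) ^ j * (A 0).ncard := by
    intro j
    induction j with
    | zero => simp
    | succ j ih =>
      calc _ ≤ _ := hstep j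
        _ ≤ (1 + C) * ((1 + C) ^ j * (A 0).ncard) := Nat.mul_le_mul_left _ ih
        _ = _ := by ring
  have hJ' : realizations D ⊆ A J := fun G hG => ⟨hG, by
    have := Set.ncard_le_ncard (Set.subset_univ (inLarge x G)) (Set.toFinite _)
    rw [Set.ncard_univ, Nat.card_eq_fintype_card, Fintype.card_fin] at this
    omega⟩
  have h0 : A 0 ⊆ realizations D \ {G | HasComponentOfOrderAtLeast x G} := by
    rintro G ⟨hG, h⟩
    refine ⟨hG, fun hc => ?_⟩
    have := (Set.ncard_pos (Set.toFinite _)).2 ((hasComponent_iff_nonempty_inLarge x).1 hc)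
    omega
  exact (Set.ncard_le_ncard hJ' (Set.toFinite _)).trans ((hiter J).trans
    (Nat.mul_le_mul_left _ (Set.ncard_le_ncard h0 (Set.toFinite _))))

end CutOff

end RandomDegreeGraph

namespace RandomDegreeGraph

/-! ### Few vertices lie on short cycles -/

section ShortCycles

variable {n : ℕ} {D : Fin n → ℕ} {G : SimpleGraph (Fin n)}

theorem DCycle.canSwitch (hG : G ∈ realizations D) {p : ℕ → Fin n} {k : ℕ} (h : DCycle D G p k)
    {x y : Fin n} (hxy : G.Adj x y) (hx : ∀ i < k, x ≠ p i) (hy : ∀ i < k, y ≠ p i) :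
    CanSwitch G (p 0) (p (k - 1)) x y := by
  have h3 := h.three_le
  refine ⟨h.close.symm, hxy, fun hadj => ?_, fun hadj => ?_, (hx 0 (by omega)).symm,
    (hy _ (by omega)).symm, (hy 0 (by omega)).symm, (hx _ (by omega)).symm⟩
  · obtain ⟨j, hj, e⟩ := h.mem_of_adj hG (by omega) hadj
    exact hx j hj e
  · obtain ⟨j, hj, e⟩ := h.mem_of_adj hG (by omega) hadj
    exact hy j hj e

theorem DCycle.dpath_switch {p : ℕ → Fin n} {k : ℕ} (h : DCycle D G p k)
    {x y : Fin n} (hx : ∀ i < k, x ≠ p i) :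
    DPath D (switch G (p 0) (p (k - 1)) x y) p k := by
  have h3 := h.three_le
  refine ⟨h.path.deg, fun i hi => ?_, h.path.inj⟩
  refine ⟨(h.path.adj i hi).ne, Or.inl ⟨h.path.adj i hi, fun he => ?_, fun he => ?_⟩⟩
  · rcases Sym2.eq_iff.1 he with ⟨e, e'⟩ | ⟨e, e'⟩
    · have h1 := h.path.inj _ (by omega) _ (by omega) e
      have h2 := h.path.inj _ (by omega) _ (by omega) e'
      omega
    · have h2 := h.path.inj _ (by omega) _ (by omega) e'
      omega
  · rcases Sym2.eq_iff.1 he with ⟨e, -⟩ | ⟨-, e⟩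
    · exact hx i (by omega) e.symm
    · exact hx (i + 1) (by omega) e.symm

/-- The realizations in which `v` lies on a cycle of `k` vertices of degree `2`. -/
def cycleThrough (D : Fin n → ℕ) (v : Fin n) (k : ℕ) : Set (SimpleGraph (Fin n)) :=
  {G | G ∈ realizations D ∧ ∃ p, DCycle D G p k ∧ p 0 = v}

/-- The cycle is opened at its closing edge and inserted into an edge `xy` off the cycle; there are
at least `n - k` choices for `x`. In the target, `x` is one of the two neighbours of `v`. Walking
from `v` away from `x` then determines the other end of the path and `y`, so at most two labels
occur. -/
theorem ncard_cycleThrough_mul_le (hD : ∀ i, 0 < D i) (v : Fin n) (k : ℕ) :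
    (cycleThrough D v k).ncard * (n - k) ≤ (realizations D).ncard * 2 := by
  refine ncard_mul_le_ncard_mul (τ := Fin n × Fin n × Fin n)
    (fun G t => switch G v t.1 t.2.1 t.2.2)
    (fun G => {t | ∃ p, DCycle D G p k ∧ p 0 = v ∧ p (k - 1) = t.1 ∧ G.Adj t.2.1 t.2.2 ∧
      (∀ i < k, t.2.1 ≠ p i) ∧ ∀ i < k, t.2.2 ≠ p i})
    (fun G => {t | ∃ p, 3 ≤ k ∧ DPath D G p k ∧ p 0 = v ∧ p (k - 1) = t.1 ∧ G.Adj v t.2.1 ∧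
      t.2.1 ≠ p 1 ∧ G.Adj t.1 t.2.2 ∧ t.2.2 ≠ p (k - 2)}) ?_ ?_ ?_ ?_ ?_
  · rintro G ⟨hG, p, hp, hp0⟩
    have hnb : ∀ x, ∃ y, G.Adj x y := fun x =>
      Set.nonempty_of_ncard_ne_zero (by rw [hG x]; exact (hD x).ne' :
        (G.neighborSet x).ncard ≠ 0)
    choose g hg using hnb
    have hcard : ((p '' Set.Iio k)ᶜ).ncard = n - k := by
      rw [Set.ncard_compl, hp.path.ncard_image, Nat.card_eq_fintype_card, Fintype.card_fin]
    rw [← hcard]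
    -- Since no edge leaves the cycle, the chosen neighbour `g x` is off the cycle whenever `x` is.
    refine Set.ncard_le_ncard_of_injOn (fun x => (p (k - 1), x, g x)) ?_ ?_ (Set.toFinite _)
    · intro x hx
      refine ⟨p, hp, hp0, rfl, hg x, fun i hi e => hx ⟨i, hi, e.symm⟩, fun i hi e => ?_⟩
      obtain ⟨j, hj, e'⟩ := hp.mem_of_adj hG hi (e ▸ (hg x).symm : G.Adj (p i) x)
      exact hx ⟨j, hj, e'.symm⟩
    · intro x _ y _ he
      simp only [Prod.mk.injEq] at he
      exact he.2.1
  · rintro G ⟨hG, -⟩ ⟨w, x, y⟩ ⟨p, hp, rfl, rfl, hxy, hx, hy⟩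
    exact switch_mem_realizations hG (hp.canSwitch hG hxy hx hy)
  · rintro G ⟨hG, -⟩ ⟨w, x, y⟩ ⟨p, hp, rfl, rfl, hxy, hx, hy⟩
    have h3 := hp.three_le
    have hs := hp.canSwitch hG hxy hx hy
    exact ⟨p, h3, hp.dpath_switch hx, rfl, rfl, switch_adj_left hs, hx 1 (by omega),
      switch_adj_right hs, hy (k - 2) (by omega)⟩
  · rintro G ⟨hG, -⟩ H ⟨hH, -⟩ ⟨w, x, y⟩ ⟨p, hp, hp0, hpw, hxy, hx, hy⟩
      ⟨q, hq, hq0, hqw, hxy', hx', hy'⟩ he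
    have h1 := hp.canSwitch hG hxy hx hy
    have h2 := hq.canSwitch hH hxy' hx' hy'
    simp only at hpw hqw
    rw [hp0, hpw] at h1
    rw [hq0, hqw] at h2
    rw [← switch_switch h1, ← switch_switch h2]
    exact congrArg (fun K => switch K _ _ _ _) he
  · intro G hG
    rcases Set.eq_empty_or_nonempty {t : Fin n × Fin n × Fin n | ∃ p, 3 ≤ k ∧ DPath D G p k ∧
      p 0 = v ∧ p (k - 1) = t.1 ∧ G.Adj v t.2.1 ∧ t.2.1 ≠ p 1 ∧ G.Adj t.1 t.2.2 ∧
      t.2.2 ≠ p (k - 2)} with he | ⟨_, p, h3, hp, hp0, -⟩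
    · rw [he]; simp
    have hv : (G.neighborSet v).ncard = 2 := by
      rw [hG v, ← hp0]
      exact hp.deg 0 (by omega)
    refine le_of_le_of_eq (Set.ncard_le_ncard_of_injOn (fun t => t.2.1) ?_ ?_ (Set.toFinite _)) hv
    · rintro t ⟨p, -, -, -, -, h, -⟩
      exact h
    · rintro ⟨w, x, y⟩ ⟨p, -, hp, hp0, hpw, hx, hx1, hy, hy1⟩ ⟨w', x', y'⟩
        ⟨q, -, hq, hq0, hqw, hx', hx1', hy', hy1'⟩ he
      simp only at hpw hx hx1 hy hy1 hqw hx' hx1' hy' hy1' he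
      subst he
      have hpq := hp.unique hG hq (a := x) (hp0.trans hq0.symm) (hp0 ▸ hx) (fun _ => hx1)
        (fun _ => hx1')
      have hw : w = w' := by rw [← hpw, ← hqw]; exact hpq _ (by omega)
      subst hw
      rw [← hpq _ (by omega)] at hy1'
      have hwadj : G.Adj w (p (k - 2)) := by
        have := hp.adj (k - 2) (by omega)
        rw [show k - 2 + 1 = k - 1 by omega, hpw] at this
        exact this.symm
      rcases eq_or_eq_of_adj hG (hpw ▸ hp.deg _ (by omega)) hwadj hy hy1.symm hy' with e | e
      · exact absurd e hy1'
      · rw [e]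

theorem sum_ncard_onShortCycle_le (l : ℕ) (A : Finset (SimpleGraph (Fin n)))
    (hA : ∀ G ∈ A, G ∈ realizations D) :
    ∑ G ∈ A, (onShortCycle D G l).ncard ≤
      ∑ v : Fin n, ∑ k ∈ Finset.range l, (cycleThrough D v k).ncard := by
  classical
  have h1 : ∀ G ∈ A, (onShortCycle D G l).ncard ≤
      ∑ v : Fin n, ∑ k ∈ Finset.range l, if G ∈ cycleThrough D v k then 1 else 0 := by
    intro G hG
    have he : (onShortCycle D G l).toFinset = Finset.univ.filter (· ∈ onShortCycle D G l) := by
      ext; simp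
    rw [Set.ncard_eq_toFinset_card', he, Finset.card_filter]
    refine Finset.sum_le_sum fun v _ => ?_
    split_ifs with hv
    · obtain ⟨p, k, hk, hp, hp0⟩ := hv
      have hmem : G ∈ cycleThrough D v k := ⟨hA G hG, p, hp, hp0⟩
      have := Finset.single_le_sum (f := fun k => if G ∈ cycleThrough D v k then 1 else 0)
        (fun i _ => Nat.zero_le _) (Finset.mem_range.2 hk)
      simpa only [if_pos hmem] using this
    · exact Nat.zero_le _
  refine (Finset.sum_le_sum h1).trans ?_
  rw [Finset.sum_comm]
  refine Finset.sum_le_sum fun v _ => ?_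
  rw [Finset.sum_comm]
  refine Finset.sum_le_sum fun k _ => ?_
  rw [Finset.sum_boole, Set.ncard_eq_toFinset_card', Nat.cast_id]
  refine Finset.card_le_card fun G hG => ?_
  simpa using (Finset.mem_filter.1 hG).2

/-- At least half of the realizations have at most a quarter of their vertices on short cycles. -/
theorem ncard_realizations_le_two_mul (hD : ∀ i, 0 < D i) {l : ℕ} (hl : 32 * l ≤ n) :
    (realizations D).ncard ≤
      2 * {G | G ∈ realizations D ∧ 4 * (onShortCycle D G l).ncard ≤ n}.ncard := by
  classical
  rcases Nat.eq_zero_or_pos n with hn | hn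
  · subst hn
    have : {G | G ∈ realizations D ∧ 4 * (onShortCycle D G l).ncard ≤ 0} = realizations D := by
      ext G
      simp [Set.eq_empty_of_isEmpty]
    rw [this]
    omega
  set R := (realizations D).ncard with hR
  set B := {G | G ∈ realizations D ∧ n < 4 * (onShortCycle D G l).ncard} with hB
  have h1 : ∀ v : Fin n, ∀ k ∈ Finset.range l, n * (cycleThrough D v k).ncard ≤ 4 * R := by
    intro v k hk
    have := ncard_cycleThrough_mul_le hD v k
    have hk' := Finset.mem_range.1 hk
    have h2 : n ≤ 2 * (n - k) := by omega
    calc _ ≤ 2 * (n - k) * (cycleThrough D v k).ncard := Nat.mul_le_mul_right _ h2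
      _ = 2 * ((cycleThrough D v k).ncard * (n - k)) := by ring
      _ ≤ 2 * (R * 2) := Nat.mul_le_mul_left _ this
      _ = _ := by ring
  have h2 : n * ∑ v : Fin n, ∑ k ∈ Finset.range l, (cycleThrough D v k).ncard ≤
      n * (l * (4 * R)) := by
    rw [Finset.mul_sum]
    refine (Finset.sum_le_card_nsmul _ _ (l * (4 * R)) fun v _ => ?_).trans (by simp)
    rw [Finset.mul_sum]
    exact (Finset.sum_le_card_nsmul _ _ (4 * R) (h1 v)).trans (by simp)
  have h3 := sum_ncard_onShortCycle_le (D := D) l B.toFinset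
    (fun G hG => (Set.mem_toFinset.1 hG).1)
  have h4 : B.ncard * n ≤ 4 * ∑ G ∈ B.toFinset, (onShortCycle D G l).ncard := by
    rw [Set.ncard_eq_toFinset_card', ← smul_eq_mul, Finset.mul_sum]
    exact Finset.card_nsmul_le_sum _ _ _ fun G hG => (Set.mem_toFinset.1 hG).2.le
  have h5 := Nat.le_of_mul_le_mul_left h2 hn
  -- Markov's inequality: the average number of vertices on short cycles is at most `4l`, and `32 *
  -- l ≤ n` makes the exceptional set at most half.
  have h6 : (2 * B.ncard) * n ≤ R * n := by
    calc _ = 2 * (B.ncard * n) := by ring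
      _ ≤ 2 * (4 * (l * (4 * R))) := by omega
      _ = R * (32 * l) := by ring
      _ ≤ _ := Nat.mul_le_mul_left _ hl
  have h7 := Nat.le_of_mul_le_mul_right h6 hn
  have h8 : realizations D ⊆
      {G | G ∈ realizations D ∧ 4 * (onShortCycle D G l).ncard ≤ n} ∪ B := fun G hG => by
    rcases le_or_gt (4 * (onShortCycle D G l).ncard) n with h | h
    · exact Or.inl ⟨hG, h⟩
    · exact Or.inr ⟨hG, h⟩
  have h9 := (Set.ncard_le_ncard h8 (Set.toFinite _)).trans (Set.ncard_union_le _ _)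
  omega

end ShortCycles

end RandomDegreeGraph

namespace RandomDegreeGraph

/-! ### Creating a large component by merging paths -/

section Merge

variable {n : ℕ} {D : Fin n → ℕ} {G : SimpleGraph (Fin n)}

/-- `q 0, …, q (k - 1)` are pairwise disjoint paths of `l` vertices of degree `2`. -/
structure DFamily (D : Fin n → ℕ) (G : SimpleGraph (Fin n)) (q : ℕ → ℕ → Fin n) (k l : ℕ) :
    Prop where
  path : ∀ i < k, DPath D G (q i) l
  disj : ∀ i < k, ∀ j < k, i ≠ j → ∀ a < l, ∀ c < l, q i a ≠ q j c

/-- A path starting outside a path `q` of vertices of degree `2` can enter it only at its ends. -/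
theorem DPath.eq_end_of_adj (hG : G ∈ realizations D) {q : ℕ → Fin n} {l a : ℕ}
    (hq : DPath D G q l) (ha : a < l) {z : Fin n} (hz : G.Adj (q a) z)
    (hzq : ∀ c < l, z ≠ q c) : a = 0 ∨ a = l - 1 := by
  by_contra hc
  obtain ⟨a, rfl⟩ : ∃ m, a = m + 1 := ⟨a - 1, by omega⟩
  rcases hq.eq_of_adj hG (by omega) hz with e | e
  · exact hzq _ (by omega) e
  · exact hzq _ (by omega) e

/-- A path is followed to its first vertex on the family. Either that is its start, or it enters
some `q i` at one of the two ends after a known number of steps, which determines the start. Each of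
the three cases has at most `k * l` codes. -/
theorem ncard_pathStarts_le (hG : G ∈ realizations D) {q : ℕ → ℕ → Fin n} {k l : ℕ}
    (hl : 2 ≤ l) (hq : DFamily D G q k l)
    (hmax : ∀ p, DPath D G p l → ∃ a < l, ∃ i < k, ∃ c < l, p a = q i c) :
    (pathStarts D G l).ncard ≤ 3 * (k * l) := by
  have hC : (Set.univ : Set (Fin 3 × Fin k × Fin l)).ncard = 3 * (k * l) := by
    simp [Set.ncard_univ]
  rw [← hC]
  refine ncard_le_ncard_of_codes (fun v c =>
    (c.1 = 0 ∧ v = q c.2.1 c.2.2) ∨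
    (c.1 = 1 ∧ ∃ p, DPath D G p (c.2.2 + 1) ∧ p 0 = v ∧ p c.2.2 = q c.2.1 0 ∧
      (1 ≤ (c.2.2 : ℕ) → q c.2.1 1 ≠ p (c.2.2 - 1))) ∨
    (c.1 = 2 ∧ ∃ p, DPath D G p (c.2.2 + 1) ∧ p 0 = v ∧ p c.2.2 = q c.2.1 (l - 1) ∧
      (1 ≤ (c.2.2 : ℕ) → q c.2.1 (l - 2) ≠ p (c.2.2 - 1)))) ?_ ?_
  · rintro v ⟨p, hp, rfl⟩
    classical
    have hex : ∃ a, a < l ∧ ∃ i < k, ∃ c < l, p a = q i c := hmax p hp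
    obtain ⟨ha, i, hi, c, hc, hpc⟩ := Nat.find_spec hex
    have hmin := fun m => Nat.find_min hex (m := m)
    set a := Nat.find hex
    rcases Nat.eq_zero_or_pos a with h0 | hpos
    · exact ⟨(0, ⟨i, hi⟩, ⟨c, hc⟩), trivial, Or.inl ⟨rfl, by rw [← h0]; exact hpc⟩⟩
    have hnot : ∀ c < l, p (a - 1) ≠ q i c := fun c hc he =>
      hmin (a - 1) (by omega) ⟨by omega, i, hi, c, hc, he⟩
    have hadj : G.Adj (q i c) (p (a - 1)) := by
      have := hp.adj (a - 1) (by omega)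
      rw [show a - 1 + 1 = a by omega, hpc] at this
      exact this.symm
    rcases (hq.path i hi).eq_end_of_adj hG hc hadj hnot with e | e
    · exact ⟨(1, ⟨i, hi⟩, ⟨a, ha⟩), trivial, Or.inr (Or.inl ⟨rfl, p, hp.mono (by simp; omega), rfl,
        e ▸ hpc, fun _ => (hnot 1 (by omega)).symm⟩)⟩
    · exact ⟨(2, ⟨i, hi⟩, ⟨a, ha⟩), trivial, Or.inr (Or.inr ⟨rfl, p, hp.mono (by simp; omega), rfl,
        e ▸ hpc, fun _ => (hnot (l - 2) (by omega)).symm⟩)⟩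
  · rintro v - w - ⟨s, i, a⟩ hv hw
    simp only at hv hw
    have hqi := hq.path i i.2
    rcases hv with ⟨rfl, rfl⟩ | ⟨rfl, p, hp, rfl, hpa, hp1⟩ | ⟨rfl, p, hp, rfl, hpa, hp1⟩
    · simp only [Fin.isValue, true_and, zero_ne_one, false_and, Fin.reduceEq, or_self,
        or_false] at hw
      exact hw.symm
    · simp only [Fin.isValue, one_ne_zero, false_and, true_and, Fin.reduceEq, false_or,
        or_false] at hw
      obtain ⟨r, hr, rfl, hra, hr1⟩ := hw
      exact hp.unique_start hG hr (hpa.trans hra.symm) (a := q i 1)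
        (hpa ▸ hqi.adj 0 (by omega)) hp1 hr1
    · simp only [Fin.isValue, Fin.reduceEq, false_and, true_and, false_or] at hw
      obtain ⟨r, hr, rfl, hra, hr1⟩ := hw
      refine hp.unique_start hG hr (hpa.trans hra.symm) (a := q i (l - 2)) ?_ hp1 hr1
      have := hqi.adj (l - 2) (by omega)
      rw [show l - 2 + 1 = l - 1 by omega] at this
      rw [hpa]
      exact this.symm

/-- Greedy choice: a family of at most `K` paths that cannot be extended would meet every path,
leaving too few starts. -/
theorem exists_dfamily (hG : G ∈ realizations D) {l K : ℕ} (hl : 2 ≤ l)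
    (h : 3 * (K * l) < (pathStarts D G l).ncard) :
    ∀ k ≤ K + 1, ∃ q, DFamily D G q k l := by
  intro k
  induction k with
  | zero =>
    obtain ⟨v, -⟩ := Set.nonempty_of_ncard_ne_zero (by omega : (pathStarts D G l).ncard ≠ 0)
    exact fun _ => ⟨fun _ _ => v, by simp, by simp⟩
  | succ k ih =>
    intro hk
    obtain ⟨q, hq⟩ := ih (by omega)
    by_contra hcon
    have h1 := ncard_pathStarts_le hG hl hq (by
      intro p hp
      by_contra hc
      push Not at hc
      refine hcon ⟨Function.update q k p, fun i hi => ?_, fun i hi j hj hij a ha c hc' => ?_⟩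
      · rcases eq_or_ne i k with rfl | h
        · simpa using hp
        · simpa [h] using hq.path i (by omega)
      · rcases eq_or_ne i k with h | h <;> rcases eq_or_ne j k with h' | h'
        · exact absurd (h.trans h'.symm) hij
        · simpa [h, h'] using hc a ha j (by omega) c hc'
        · simpa [h, h'] using (hc c hc' i (by omega) a ha).symm
        · simpa [h, h'] using hq.disj i (by omega) j (by omega) hij a ha c hc')
    have h2 : k * l ≤ K * l := Nat.mul_le_mul_right _ (by omega)
    omega

/-- The realizations containing a path of `m` vertices of degree `2` and `k` paths of `l` vertices
of degree `2`, all of them disjoint. -/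
def pathWithFamily (D : Fin n → ℕ) (l k m : ℕ) : Set (SimpleGraph (Fin n)) :=
  {G | G ∈ realizations D ∧ ∃ P q, DPath D G P m ∧ DFamily D G q k l ∧
    ∀ i < k, ∀ a < m, ∀ c < l, P a ≠ q i c}

theorem DFamily.mem_pathWithFamily (hG : G ∈ realizations D) {q : ℕ → ℕ → Fin n} {k l : ℕ}
    (hq : DFamily D G q (k + 1) l) : G ∈ pathWithFamily D l k l :=
  ⟨hG, q k, q, hq.path k (by omega),
    ⟨fun i hi => hq.path i (by omega), fun i hi j hj => hq.disj i (by omega) j (by omega)⟩,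
    fun i hi a ha c hc => hq.disj k (by omega) i (by omega) (by omega) a ha c hc⟩

/-- A path avoiding one end of each edge deleted by a switch survives it. -/
theorem DPath.switch {p : ℕ → Fin n} {k : ℕ} (h : DPath D G p k) {u v x y : Fin n}
    (hu : ∀ a < k, u ≠ p a) (hx : ∀ a < k, x ≠ p a) :
    DPath D (switch G u v x y) p k := by
  refine ⟨h.deg, fun i hi => ⟨(h.adj i hi).ne, Or.inl ⟨h.adj i hi, fun he => ?_, fun he => ?_⟩⟩,
    h.inj⟩
  · rcases Sym2.eq_iff.1 he with ⟨e, -⟩ | ⟨-, e⟩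
    · exact hu i (by omega) e.symm
    · exact hu (i + 1) (by omega) e.symm
  · rcases Sym2.eq_iff.1 he with ⟨e, -⟩ | ⟨-, e⟩
    · exact hx i (by omega) e.symm
    · exact hx (i + 1) (by omega) e.symm

theorem DPath.canSwitch_merge (hG : G ∈ realizations D) {P Q : ℕ → Fin n} {m l i j : ℕ}
    (hP : DPath D G P m) (hQ : DPath D G Q l) (hPQ : ∀ a < m, ∀ c < l, P a ≠ Q c)
    (hi : 1 ≤ i) (him : i + 2 < m) (hj : j + 1 < l) :
    CanSwitch G (P i) (P (i + 1)) (Q (j + 1)) (Q j) := by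
  refine ⟨hP.adj i (by omega), (hQ.adj j hj).symm, fun hadj => ?_, fun hadj => ?_,
    hPQ _ (by omega) _ (by omega), hPQ _ (by omega) _ (by omega), hPQ _ (by omega) _ (by omega),
    hPQ _ (by omega) _ (by omega)⟩
  · obtain ⟨i, rfl⟩ : ∃ r, i = r + 1 := ⟨i - 1, by omega⟩
    rcases hP.eq_of_adj hG (by omega) hadj with e | e
    · exact hPQ _ (by omega) _ (by omega) e.symm
    · exact hPQ _ (by omega) _ (by omega) e.symm
  · rcases hP.eq_of_adj hG (by omega) hadj with e | e
    · exact hPQ _ (by omega) _ (by omega) e.symm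
    · exact hPQ _ (by omega) _ (by omega) e.symm

/-- The new path runs along `P 0, …, P i` and jumps over the inserted edge to `Q (j + 1), …, Q (l -
1)`. -/
theorem DPath.merge {P Q : ℕ → Fin n} {m l i j : ℕ}
    (hP : DPath D G P m) (hQ : DPath D G Q l) (hPQ : ∀ a < m, ∀ c < l, P a ≠ Q c)
    (hs : CanSwitch G (P i) (P (i + 1)) (Q (j + 1)) (Q j))
    (him : i + 2 < m) (hj : j + 1 < l) :
    DPath D (RandomDegreeGraph.switch G (P i) (P (i + 1)) (Q (j + 1)) (Q j))
      (fun s => if s ≤ i then P s else Q (s - i + j)) (i + l - j) := by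
  refine ⟨fun s hs => ?_, fun s hs' => ?_, fun s hs s' hs' he => ?_⟩
  · split_ifs
    · exact hP.deg _ (by omega)
    · exact hQ.deg _ (by omega)
  · rcases lt_trichotomy s i with h | h | h
    · rw [if_pos h.le, if_pos (by omega)]
      have hadj := hP.adj s (by omega)
      refine ⟨hadj.ne, Or.inl ⟨hadj, fun he => ?_, fun he => ?_⟩⟩
      · rcases Sym2.eq_iff.1 he with ⟨e, -⟩ | ⟨e, -⟩
        · have := hP.inj _ (by omega) _ (by omega) e
          omega
        · have := hP.inj _ (by omega) _ (by omega) e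
          omega
      · rcases Sym2.eq_iff.1 he with ⟨e, -⟩ | ⟨e, -⟩
        · exact hPQ _ (by omega) _ (by omega) e
        · exact hPQ _ (by omega) _ (by omega) e
    · subst h
      rw [if_pos le_rfl, if_neg (by omega), show s + 1 - s + j = j + 1 by omega]
      exact switch_adj_left hs
    · rw [if_neg (by omega), if_neg (by omega), show s + 1 - i + j = s - i + j + 1 by omega]
      have hadj := hQ.adj (s - i + j) (by omega)
      refine ⟨hadj.ne, Or.inl ⟨hadj, fun he => ?_, fun he => ?_⟩⟩
      · rcases Sym2.eq_iff.1 he with ⟨e, -⟩ | ⟨e, -⟩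
        · exact hPQ _ (by omega) _ (by omega) e.symm
        · exact hPQ _ (by omega) _ (by omega) e.symm
      · rcases Sym2.eq_iff.1 he with ⟨-, e⟩ | ⟨e, -⟩
        · have := hQ.inj _ (by omega) _ (by omega) e
          omega
        · have := hQ.inj _ (by omega) _ (by omega) e
          omega
  · split_ifs at he
    · exact hP.inj _ (by omega) _ (by omega) he
    · exact absurd he (hPQ _ (by omega) _ (by omega))
    · exact absurd he.symm (hPQ _ (by omega) _ (by omega))
    · have := hQ.inj _ (by omega) _ (by omega) he
      omega

theorem ncard_pathWithFamily_succ_mul_le {l k m m' t : ℕ} (hm : t + 4 ≤ m) (hl : t < l)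
    (hm' : m' + (2 * t + 1) ≤ m + l) :
    (pathWithFamily D l (k + 1) m).ncard * (t * t) ≤
      (pathWithFamily D l k m').ncard * ((∑ i, D i) * ∑ i, D i) := by
  refine ncard_mul_le_of_switch (fun G hG => hG.1) ?_
  rintro G ⟨hG, P, q, hP, hq, hPq⟩
  have hQ := hq.path k (by omega)
  have hPQ := hPq k (by omega)
  refine mul_le_ncard_of_injective
    -- Cuts within about `t` of the end of `P` and of the start of `q k` give `t * t` switches and
    -- lose at most `2 * t + 1` vertices. The offset 3 keeps `P (i + 1)` an inner vertex.
    (fun a c => (P (m - 3 - a), P (m - 3 - a + 1), q k (c + 1), q k c)) ?_ ?_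
  · intro a ha c hc
    have hs := hP.canSwitch_merge hG hQ hPQ (i := m - 3 - a) (j := c) (by omega) (by omega)
      (by omega)
    have hmerge := hP.merge hQ hPQ hs (by omega) (by omega)
    refine ⟨hs, switch_mem_realizations hG hs, _, q, hmerge.mono (by omega), ⟨fun i hi => ?_,
      fun i hi j hj => hq.disj i (by omega) j (by omega)⟩, fun i hi s hs' d hd => ?_⟩
    · exact (hq.path i (by omega)).switch (fun b hb => hPq i (by omega) _ (by omega) b hb)
        (fun b hb => hq.disj k (by omega) i (by omega) (by omega) _ (by omega) b hb)
    · split_ifs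
      · exact hPq i (by omega) _ (by omega) d hd
      · exact hq.disj k (by omega) i (by omega) (by omega) _ (by omega) d hd
  · intro a ha c hc a' ha' c' hc' he
    simp only [Prod.mk.injEq] at he
    have h1 := hP.inj _ (by omega) _ (by omega) he.1
    have h2 := hQ.inj _ (by omega) _ (by omega) he.2.2.2
    omega

theorem ncard_pathWithFamily_le {l k m t C : ℕ} (ht : 0 < t) (hm : t + 4 ≤ m)
    (hl : 2 * t + 1 ≤ l) (hC : (∑ i, D i) * ∑ i, D i ≤ C * (t * t)) :
    (pathWithFamily D l k m).ncard ≤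
      C ^ k * (pathWithFamily D l 0 (m + k * (l - (2 * t + 1)))).ncard := by
  induction k generalizing m with
  | zero => simp
  | succ k ih =>
    have h1 := ncard_pathWithFamily_succ_mul_le (D := D) (l := l) (k := k) (m := m)
      (m' := m + (l - (2 * t + 1))) (t := t) hm (by omega) (by omega)
    have h2 : (pathWithFamily D l (k + 1) m).ncard * (t * t) ≤
        (C * (pathWithFamily D l k (m + (l - (2 * t + 1)))).ncard) * (t * t) :=
      h1.trans ((Nat.mul_le_mul_left _ hC).trans_eq (by ring))
    have h3 := Nat.le_of_mul_le_mul_right h2 (by positivity)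
    have h4 := ih (m := m + (l - (2 * t + 1))) (by omega)
    rw [show m + (l - (2 * t + 1)) + k * (l - (2 * t + 1)) =
      m + (k + 1) * (l - (2 * t + 1)) by ring] at h4
    calc _ ≤ _ := h3
      _ ≤ _ := Nat.mul_le_mul_left _ h4
      _ = _ := by ring

theorem hasComponent_of_mem_pathWithFamily {l m : ℕ} {x : ℝ} (hx : x ≤ m) (hm : 0 < m)
    (hG : G ∈ pathWithFamily D l 0 m) : HasComponentOfOrderAtLeast x G := by
  obtain ⟨-, P, -, hP, -⟩ := hG
  refine ⟨G.connectedComponentMk (P 0), hx.trans ?_⟩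
  have hs : P '' Set.Iio m ⊆ (G.connectedComponentMk (P 0)).supp := by
    rintro _ ⟨a, ha, rfl⟩
    exact SimpleGraph.ConnectedComponent.sound (hP.reachable ha hm)
  have := Set.ncard_le_ncard hs (Set.toFinite _)
  rw [hP.ncard_image] at this
  exact_mod_cast this

/-- A fixed proportion of the realizations has a component containing a long path of vertices of degree
`2`. -/
theorem ncard_realizations_le_of_merge (hD : ∀ i, 0 < D i) {l t C K : ℕ} {x : ℝ} (ht : 0 < t)
    (hlt : 2 * t + 4 ≤ l) (hl : 32 * l ≤ n)
    (hK : sumDegNeTwo D + sumDegNeTwo D * l + n / 4 + 3 * (K * l) < n)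
    (hC : (∑ i, D i) * ∑ i, D i ≤ C * (t * t))
    (hx : x ≤ ((l + K * (l - (2 * t + 1)) : ℕ) : ℝ)) :
    (realizations D).ncard ≤
      2 * C ^ K * (realizations D ∩ {G | HasComponentOfOrderAtLeast x G}).ncard := by
  have h1 := ncard_realizations_le_two_mul hD hl
  have h2 : {G | G ∈ realizations D ∧ 4 * (onShortCycle D G l).ncard ≤ n} ⊆
      pathWithFamily D l K l := by
    rintro G ⟨hG, h⟩
    have h3 := le_ncard_pathStarts hD hG l Set.univ
    rw [Set.univ_inter, Set.univ_inter, Set.ncard_univ, Nat.card_eq_fintype_card,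
      Fintype.card_fin] at h3
    -- By `hK`, more than `3 * (K * l)` starts remain after at most `n / 4` are lost to short
    -- cycles. One of the `K + 1` paths becomes the growing path.
    obtain ⟨q, hq⟩ := exists_dfamily hG (K := K) (by omega : 2 ≤ l) (by omega) (K + 1) le_rfl
    exact hq.mem_pathWithFamily hG
  have h3 := Set.ncard_le_ncard h2 (Set.toFinite _)
  have h4 := ncard_pathWithFamily_le (D := D) (k := K) (m := l) ht (by omega)
    (by omega : 2 * t + 1 ≤ l) hC
  have h5 : pathWithFamily D l 0 (l + K * (l - (2 * t + 1))) ⊆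
      realizations D ∩ {G | HasComponentOfOrderAtLeast x G} := fun G hG =>
    ⟨hG.1, hasComponent_of_mem_pathWithFamily hx (by omega) hG⟩
  have h6 := Set.ncard_le_ncard h5 (Set.toFinite _)
  calc _ ≤ _ := h1
    _ ≤ 2 * (C ^ K * (realizations D ∩ {G | HasComponentOfOrderAtLeast x G}).ncard) :=
      Nat.mul_le_mul_left _ (h3.trans (h4.trans (Nat.mul_le_mul_left _ h6)))
    _ = _ := by ring

end Merge

end RandomDegreeGraph

namespace RandomDegreeGraph

/-! ### Choice of constants -/

section Constants

variable {n : ℕ} {D : Fin n → ℕ}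

theorem sum_le_sumDegNeTwo_add : ∑ i, D i ≤ sumDegNeTwo D + 2 * n := by
  rw [sumDegNeTwo, ← Finset.sum_filter_add_sum_filter_not Finset.univ (fun i => D i ≠ 2)]
  refine Nat.add_le_add_left ?_ _
  refine (Finset.sum_le_card_nsmul _ _ 2 fun i hi => ?_).trans ?_
  · exact (not_not.1 (Finset.mem_filter.1 hi).2).le
  · have := Finset.card_filter_le (Finset.univ : Finset (Fin n)) (fun i => ¬ D i ≠ 2)
    simp only [Finset.card_univ, Fintype.card_fin] at this
    rw [smul_eq_mul]
    omega

/-- The degree sum is at most `3n`, and rounding gives `n ≤ 2B⌊n/B⌋`; the square of 6 is 36. -/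
theorem sum_mul_sum_le {B : ℕ} (hB : 0 < B) (hn : B ≤ n) (hM : sumDegNeTwo D ≤ n) :
    (∑ i, D i) * ∑ i, D i ≤ 36 * B ^ 2 * ((n / B) * (n / B)) := by
  have h1 : ∑ i, D i ≤ 3 * n := sum_le_sumDegNeTwo_add.trans (by omega)
  have h2 : n ≤ 2 * (B * (n / B)) := by
    have h3 : 1 ≤ n / B := (Nat.one_le_div_iff hB).2 hn
    have h4 : B * 1 ≤ B * (n / B) := Nat.mul_le_mul_left B h3
    have h5 := Nat.div_add_mod n B
    have h6 := Nat.mod_lt n hB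
    omega
  have h3 : ∑ i, D i ≤ 6 * (B * (n / B)) := by omega
  exact (Nat.mul_le_mul h3 h3).trans_eq (by ring)

theorem ncard_le_of_large {A : ℕ} {γ : ℝ} (hγ : γ < 1 / 8) (hD : ∀ i, 0 < D i)
    (hM : sumDegNeTwo D + 6 ≤ A) (hn : 200 * A ≤ n) :
    (realizations D).ncard ≤ 2 * (36 * (96 * A) ^ 2) ^ (A - 1) *
      (realizations D ∩ {G | HasComponentOfOrderAtLeast (γ * n) G}).ncard := by
  set M := sumDegNeTwo D
  -- The `A` paths cover about `n/6` vertices and merging loses about `2At ≈ n/48`, leaving `7n/48 >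
  -- n/8`. For the starts, `n/4 + Ml + 3Al` is at most `(1/4 + 1/6 + 1/2)n = 11n/12`; `200 * A ≤ n`
  -- absorbs the remaining `M` and the rounding.
  set l := n / (6 * A) with hl
  set t := n / (96 * A) with ht
  have hA : 0 < A := by omega
  have hl1 : 6 * (A * l) ≤ n := by
    have := Nat.mul_div_le n (6 * A); rw [← hl] at this; linarith
  have hl2 : n < 6 * (A * l) + 6 * A := by
    have := Nat.lt_mul_div_succ n (by positivity : 0 < 6 * A); rw [← hl] at this; linarith
  have ht1 : 96 * (A * t) ≤ n := by
    have := Nat.mul_div_le n (96 * A); rw [← ht] at this; linarith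
  have ht2 : n < 96 * (A * t) + 96 * A := by
    have := Nat.lt_mul_div_succ n (by positivity : 0 < 96 * A); rw [← ht] at this; linarith
  have htpos : 0 < t := by
    rcases Nat.eq_zero_or_pos t with h | h
    · rw [h] at ht2; omega
    · exact h
  have hlt : 2 * t + 4 ≤ l := by
    by_contra hc
    have : A * l ≤ A * (2 * t + 3) := Nat.mul_le_mul_left _ (by omega)
    have e : A * (2 * t + 3) = 2 * (A * t) + 3 * A := by ring
    omega
  have hln : 32 * l ≤ n := by
    have : 6 * l ≤ A * l := Nat.mul_le_mul_right _ (by omega)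
    omega
  refine ncard_realizations_le_of_merge hD htpos hlt hln ?_
    (sum_mul_sum_le (by positivity) (by omega) (by omega)) ?_
  · obtain ⟨K, rfl⟩ : ∃ K, A = K + 1 := ⟨A - 1, by omega⟩
    have h1 : M * l ≤ (K + 1) * l := Nat.mul_le_mul_right _ (by omega)
    have h2 : K * l ≤ (K + 1) * l := Nat.mul_le_mul_right _ (by omega)
    simp only [Nat.add_sub_cancel]
    change M + M * l + n / 4 + 3 * (K * l) < n
    omega
  · obtain ⟨K, rfl⟩ : ∃ K, A = K + 1 := ⟨A - 1, by omega⟩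
    simp only [Nat.add_sub_cancel]
    obtain ⟨d, hd⟩ : ∃ d, l = d + (2 * t + 1) := ⟨l - (2 * t + 1), by omega⟩
    have hd' : l - (2 * t + 1) = d := by omega
    rw [hd']
    have e : (K + 1) * l = (K + 1) * d + 2 * ((K + 1) * t) + (K + 1) := by rw [hd]; ring
    have e' : (K + 1) * d = K * d + d := by ring
    have h8 : n ≤ 8 * (l + K * d) := by omega
    have h8' : (n : ℝ) ≤ 8 * ((l + K * d : ℕ) : ℝ) := by exact_mod_cast h8
    have : γ * n ≤ 1 / 8 * n := mul_le_mul_of_nonneg_right hγ.le (Nat.cast_nonneg n)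
    linarith

theorem ncard_le_of_small {B β : ℕ} {γ : ℝ} (hγ : 0 < γ) (hD : ∀ i, 0 < D i)
    (hM : sumDegNeTwo D ≤ β) (hB : 6 * ((β : ℝ) + 1) ≤ B * γ) (hnB : 3 * B + β ≤ n)
    (hn : 4 * (β : ℝ) + 2 < γ * n) :
    (realizations D).ncard ≤ (1 + 36 * B ^ 2) ^ (2 * B) *
      (realizations D \ {G | HasComponentOfOrderAtLeast (γ * n) G}).ncard := by
  have hβ : (0 : ℝ) ≤ β := Nat.cast_nonneg _
  have hBpos : 0 < B := by
    rcases Nat.eq_zero_or_pos B with h | h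
    · rw [h] at hB
      norm_num at hB
      linarith
    · exact h
  set t := n / B with ht
  have ht1 : B * t ≤ n := Nat.mul_div_le n B
  have ht3 : 3 ≤ t := (Nat.le_div_iff_mul_le hBpos).2 (by omega)
  have hJ : n ≤ 2 * B * t := by
    have h1 : n < B * (t + 1) := Nat.lt_mul_div_succ n hBpos
    have h2 : B * 1 ≤ B * t := Nat.mul_le_mul_left _ (by omega)
    have e : B * (t + 1) = B * t + B := by ring
    have e' : 2 * B * t = B * t + B * t := by ring
    omega
  -- Thus `3t` and `3βt` are each at most `γn/2`; the bound `4β + 2 < γn` puts the remaining terms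
  -- `1` and `2β` below the other half.
  have hkey : 6 * ((β : ℝ) + 1) * t ≤ γ * n := by
    have h1 : (B : ℝ) * t ≤ n := by exact_mod_cast ht1
    calc 6 * ((β : ℝ) + 1) * t ≤ B * γ * t :=
          mul_le_mul_of_nonneg_right hB (Nat.cast_nonneg _)
      _ = γ * (B * t) := by ring
      _ ≤ _ := mul_le_mul_of_nonneg_left h1 hγ.le
  have ht0 : (0 : ℝ) ≤ t := Nat.cast_nonneg _
  have hβt : 0 ≤ (β : ℝ) * t := mul_nonneg hβ ht0
  refine ncard_realizations_le_of_cutOff hD ht3 ?_ ?_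
    (sum_mul_sum_le hBpos (by omega) (by omega)) hJ
  · push_cast
    nlinarith
  · have h1 : ((sumDegNeTwo D + sumDegNeTwo D * (3 * t + 1) : ℕ) : ℝ) ≤
        ((β + β * (3 * t + 1) : ℕ) : ℝ) := by
      exact_mod_cast Nat.add_le_add hM (Nat.mul_le_mul_right _ hM)
    refine h1.trans_lt ?_
    push_cast
    nlinarith

end Constants

end RandomDegreeGraph

/-! ### The main theorem -/

open RandomDegreeGraph in
theorem theorem6 (b : ℝ) (hb : 0 ≤ b) (γ : ℝ) (hγ0 : 0 < γ) (hγ : γ < 1 / 8) :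
    ∃ (N : ℕ) (δ : ℝ), 0 < N ∧ 0 < δ ∧ δ < 1 ∧
      ∀ (n : ℕ) (D : Fin n → ℕ), N < n → (∀ i, 0 < D i) → RandomDegreeGraph.Feasible D →
        (RandomDegreeGraph.sumDegNeTwo D : ℝ) ≤ b →
        δ ≤ RandomDegreeGraph.prob D
              (RandomDegreeGraph.HasComponentOfOrderAtLeast (γ * (n : ℝ))) ∧
        RandomDegreeGraph.prob D
            (RandomDegreeGraph.HasComponentOfOrderAtLeast (γ * (n : ℝ))) ≤ 1 - δ := by
  obtain ⟨β, hβ⟩ := exists_nat_ge b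
  obtain ⟨B, hB⟩ := exists_nat_ge (6 * ((β : ℝ) + 1) / γ)
  obtain ⟨N₀, hN₀⟩ := exists_nat_gt ((4 * (β : ℝ) + 2) / γ)
  rw [div_le_iff₀ hγ0] at hB
  rw [div_lt_iff₀ hγ0] at hN₀
  obtain ⟨c, hc⟩ : ∃ c : ℕ, c = 2 * (36 * (96 * (β + 6)) ^ 2) ^ (β + 6 - 1) := ⟨_, rfl⟩
  obtain ⟨c', hc'⟩ : ∃ c' : ℕ, c' = (1 + 36 * B ^ 2) ^ (2 * B) := ⟨_, rfl⟩
  have hcpos : 0 < c := by rw [hc]; positivity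
  have hc'pos : 0 < c' := by rw [hc']; positivity
  -- The realizations with and without a large component make up fractions at least `1/c` and
  -- `1/c'`. The sum `c + c'` serves both bounds and exceeds 1.
  refine ⟨200 * (β + 6) + 3 * B + N₀, 1 / ((c + c' : ℕ) : ℝ), by omega, by positivity, ?_, ?_⟩
  · rw [div_lt_one (by positivity)]
    exact_mod_cast (by omega : 1 < c + c')
  intro n D hn hD hF hM
  have hMβ : sumDegNeTwo D ≤ β := by exact_mod_cast hM.trans hβ
  have h1 := ncard_le_of_large (A := β + 6) hγ hD (by omega) (by omega : 200 * (β + 6) ≤ n)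
  have h2 := ncard_le_of_small hγ0 hD hMβ hB (by omega) (by
    have : (N₀ : ℝ) ≤ n := by exact_mod_cast (by omega : N₀ ≤ n)
    nlinarith)
  rw [← hc] at h1
  rw [← hc'] at h2
  have hR : 0 < (realizations D).ncard := (Set.ncard_pos (Set.toFinite _)).2 hF
  have hsum := Set.ncard_inter_add_ncard_sdiff_eq_ncard (realizations D)
    {G | HasComponentOfOrderAtLeast (γ * n) G} (Set.toFinite _)
  unfold prob
  set R := (realizations D).ncard
  set P := (realizations D ∩ {G | HasComponentOfOrderAtLeast (γ * n) G}).ncard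
  set Q := (realizations D \ {G | HasComponentOfOrderAtLeast (γ * n) G}).ncard
  have hR' : (0 : ℝ) < R := by exact_mod_cast hR
  have hP : (R : ℝ) ≤ ((c + c' : ℕ) : ℝ) * P := by
    exact_mod_cast h1.trans (Nat.mul_le_mul_right _ (by omega))
  have hQ : (R : ℝ) ≤ ((c + c' : ℕ) : ℝ) * Q := by
    exact_mod_cast h2.trans (Nat.mul_le_mul_right _ (by omega))
  have hPQ : (P : ℝ) + Q = R := by exact_mod_cast hsum
  have hcc : (0 : ℝ) < ((c + c' : ℕ) : ℝ) := by positivity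
  constructor
  · rw [div_le_div_iff₀ hcc hR']
    linarith
  · have h3 : 1 / ((c + c' : ℕ) : ℝ) ≤ Q / R := by
      rw [div_le_div_iff₀ hcc hR']
      linarith
    have h4 : (P : ℝ) / R = 1 - Q / R := by
      rw [eq_sub_iff_add_eq, ← add_div, hPQ, div_self hR'.ne']
    linarith
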